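/- Let Sol be $\mathbb R^3$ with the Riemannian metric $e^{-2z}dx^2+e^{2z}dy^2+dz^2$, and let $E:\mathbb R^3\to \mathrm{Sol}$ be its Riemannian exponential map at the identity $(0,0,0)$. Let $\Sigma(x,y,z)=(xz,\,-yz,\,-x^2+y^2)$; its flow preserves the unit sphere $S^2$ and the function $xy$. A loop level set is a closed loop of $S^2$ that is a connected component of a level set of $xy$ on $S^2$; its period is the time that the flow of $\Sigma$ takes to run exactly once around it. A nonzero vector $V$ determines the flowline of $\Sigma$ that starts at $V/\|V\|$ and runs for time $\|V\|$. A flowline in a loop level set of period $L$ is small symmetric if it runs for a time $T$ with $0<T<L$ and goes from a point $(x,y,z)$ to the point $(x,y,-z)$. A vector $V$ is distinguished if its flowline can be prolonged, keeping its initial point, to a small symmetric flowline; it is positive if all its coordinates are positive; it is perfect if its flowline runs exactly once around a loop level set, or if $V=(\pm\pi,\pm\pi,0)$ (any choice of signs). The cut-locus image is the set of all $E(V)$ with $V$ perfect. (1) For every $\varepsilon>0$ there is $L_0$ such that, for every $L>L_0$ and every distinguished positive vector $V$ whose flowline lies in a loop level set of period $L$, the point $E(V)=(a,b,c)$ satisfies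 $0<b<2+\varepsilon$. (2) The boundary of the cut-locus image in the positive quadrant of the plane $z=0$ is asymptotic to the lines $y=2$ and $x=2$: for $a$ sufficiently large, the set of all $b>0$ such that $(a,b,0)$ is in the cut-locus image is non-empty, and its infimum tends to $2$ as $a\to\infty$; likewise, for $b$ sufficiently large, the set of all $a>0$ such that $(a,b,0)$ is in the cut-locus image is non-empty, and its infimum tends to $2$ as $b\to\infty$. -/

import Mathlib

namespace SolGeom

/-- Both the underlying space `ℝ³` of Sol and its Lie algebra, with coordinates
`x = p 0`, `y = p 1`, `z = p 2`.  The norm is the Euclidean one, which is the norm that the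
Riemannian metric of Sol induces on the tangent space at the identity `(0,0,0)`. -/
abbrev E3 : Type := EuclideanSpace ℝ (Fin 3)

/-- The metric `e^{-2z} dx² + e^{2z} dy² + dz²` of Sol, as a matrix depending on the point. -/
noncomputable def solMetric (p : E3) : Matrix (Fin 3) (Fin 3) ℝ :=
  Matrix.diagonal ![Real.exp (-2 * p 2), Real.exp (2 * p 2), 1]

/-- The partial derivative `∂f/∂xᵢ` at `p`. -/
noncomputable def partialDeriv (i : Fin 3) (f : E3 → ℝ) (p : E3) : ℝ :=
  fderiv ℝ f p (EuclideanSpace.single i 1)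

/-- The Christoffel symbol
`Γᵏᵢⱼ = ½ ∑ₗ gᵏˡ (∂ᵢ gⱼₗ + ∂ⱼ gᵢₗ - ∂ₗ gᵢⱼ)` of the metric of Sol. -/
noncomputable def christoffel (k i j : Fin 3) (p : E3) : ℝ :=
  (1 / 2) * ∑ l, (solMetric p)⁻¹ k l *
    (partialDeriv i (fun q => solMetric q j l) p + partialDeriv j (fun q => solMetric q i l) p
      - partialDeriv l (fun q => solMetric q i j) p)

/-- `γ` is a (complete, affinely parametrized) geodesic of Sol: with velocity `v = γ'`,
`vᵏ' = - ∑ᵢⱼ Γᵏᵢⱼ(γ) vⁱ vʲ` for all times. -/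
def IsGeodesic (γ : ℝ → E3) : Prop :=
  ∃ v : ℝ → E3, (∀ t, HasDerivAt γ (v t) t) ∧
    ∀ t, HasDerivAt v
      (WithLp.toLp 2 fun k => -∑ i, ∑ j, christoffel k i j (γ t) * v t i * v t j) t

open Classical in
/-- The Riemannian exponential map `E` of Sol at the identity: `E(V) = γ(1)` for the geodesic
`γ` with `γ(0) = 0` and `γ'(0) = V` (it exists, since Sol is complete, and is unique). -/
noncomputable def solExp (V : E3) : E3 :=
  if h : ∃ γ : ℝ → E3, IsGeodesic γ ∧ γ 0 = 0 ∧ HasDerivAt γ V 0 then h.choose 1 else 0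

/-- The structure field `Σ(x,y,z) = (xz, -yz, -x² + y²)`: geodesic flow on the unit tangent
bundle, seen in the left-invariant frame.  It is tangent to the unit sphere and to the level
sets of `F(x,y,z) = xy`. -/
noncomputable def structureField (p : E3) : E3 :=
  !₂[p 0 * p 2, -(p 1 * p 2), -(p 0) ^ 2 + (p 1) ^ 2]

/-- `φ` is an integral curve of the structure field, starting at `u`. -/
def IsFlowFrom (φ : ℝ → E3) (u : E3) : Prop :=
  φ 0 = u ∧ ∀ t, HasDerivAt φ (structureField (φ t)) t

/-- The unit vector `u` lies in a loop level set of period `L`: the flow through `u`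
runs around a closed loop (a component of a level set of `xy` on the unit sphere), and
`L` is the time that it takes to flow exactly once around, i.e. the first positive return time.
Equilibria have no first positive return time and points with `xy = 0` that are not equilibria
do not return, so these points lie in no loop level set. -/
def InLoopLevelSet (u : E3) (L : ℝ) : Prop :=
  ‖u‖ = 1 ∧ ∃ φ : ℝ → E3, IsFlowFrom φ u ∧ IsLeast {T : ℝ | 0 < T ∧ φ T = u} L

/-- The flowline that starts at the point `u` of a loop level set and runs for time `T` is small
(`T` is less than the period) and symmetric (it goes from `(x,y,z)` to `(x,y,-z)`). -/
def IsSmallSymmetric (u : E3) (T : ℝ) : Prop :=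
  0 < T ∧ (∃ L, InLoopLevelSet u L ∧ T < L) ∧
    ∃ φ : ℝ → E3, IsFlowFrom φ u ∧ φ T = !₂[u 0, u 1, -(u 2)]

/-- The starting point `V / ‖V‖` of the flowline of `V`, which runs for time `‖V‖`. -/
noncomputable def direction (V : E3) : E3 := ‖V‖⁻¹ • V

/-- All coordinates of the vector are positive. -/
def IsPositive (V : E3) : Prop := ∀ i, 0 < V i

/-- The flowline of `V` can be prolonged until it is a small symmetric flowline. -/
def IsDistinguished (V : E3) : Prop :=
  ∃ T, ‖V‖ ≤ T ∧ IsSmallSymmetric (direction V) T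

/-- `V` is perfect: its flowline runs exactly once around a loop level set, or
`V = (±π, ±π, 0)` (the limiting case, where `V / ‖V‖` is an equilibrium). -/
def IsPerfect (V : E3) : Prop :=
  InLoopLevelSet (direction V) ‖V‖ ∨ (|V 0| = Real.pi ∧ |V 1| = Real.pi ∧ V 2 = 0)

/-- The image under `E` of the set of perfect vectors (the cut locus of the identity). -/
def cutLocusImage : Set E3 := solExp '' {V | IsPerfect V}

end SolGeom

/-!
In the left-invariant orthonormal frame the velocity of a geodesic of Sol is an integral curve `u`
of the structure field, and the position is recovered from `x' = e^z u₀`, `y' = e^{-z} u₁`,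
`z' = u₂` (`solExp_smul`). Both `‖u‖` and `u₀ u₁` are conserved. On the level set `xy = h` of the
unit sphere, with `0 < h < 1/2` and `p = √(1 - 2h)`, the angle `θ` of the vector `(z, x - y)`
satisfies `θ' = f(θ)` with `f = √(4h + p² sin² θ)`, and the frame coordinates are
`x, y = (f ± p sin θ) / 2` and `z = p cos θ` (`isFlowFrom_orbit`). Inverting the time `∫ dθ / f`
gives the flow, the period `P(h)` is the integral of `1 / f` over one turn, and, as `e^z` is
proportional to the first frame coordinate, the exponential map becomes a pair of integrals of
`x² / f` and `y² / f` over `θ` (`solExp_smul_orbit`).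

The inequality `1/f ≤ (l/f² + 1/l)/2` bounds `P(h)` by a multiple of `h^(-1/4)`
(`period_mul_le`), so that `√h P(h) ≤ 25 / P(h)` is small when the period is large.

A small symmetric flowline in the positive sector runs from an angle `a` to `π - a`, and its
displacement in the `y` direction is the integral of `y² / f`, divided by the initial value of `y`.
If `a < 0`, that initial value is at least `√h`, and `y² / f ≤ h / f + p max(0, -sin θ)`, where the
last term integrates to at most twice the initial value. If `a ≥ 0`, then `y` never exceeds its
initial value, which is at most `√h`. So the displacement is at most `2 + √h P(h)`
(`integral_orbit_one_sq_symmetric_le`).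

Over a full turn `x²` and `y²` have the same integral `I(h)`, and `2p ≤ I(h) ≤ 2 + h P(h)`.
A perfect vector in the direction `(x, y, z)` with `x, y > 0` is therefore sent to
`(I(h)/x, I(h)/y, 0)`. Hence, away from `(π, π, 0)`, a point `(a, b, 0)` with `a, b > 0` is in the
cut-locus image exactly when `a b h = I(h)²` and `h (a² + b²) ≤ a b` for some level `h`
(`mem_cutLocusImage_iff`), a relation symmetric in `a` and `b`. For large `a` and bounded `b` it
forces `h ≤ b / a`, so `b ≥ I(h)` is almost `2`; conversely `h = (2 - ε/4) / a` gives an admissible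
`b` below `2 + ε`. No monotonicity of `P` or `I` is used.
-/

namespace SolGeom

/-! ### Integral curves of the structure field -/

theorem hasDerivAt_iff_coord {φ : ℝ → E3} {φ' : E3} {t : ℝ} :
    HasDerivAt φ φ' t ↔ ∀ i, HasDerivAt (fun s => φ s i) (φ' i) t := by
  simp only [← hasDerivWithinAt_univ, hasDerivWithinAt_iff_hasFDerivWithinAt]
  rw [hasFDerivWithinAt_euclidean]
  refine forall_congr' fun i => ?_
  rw [show (EuclideanSpace.proj i : E3 →L[ℝ] ℝ) ∘L (ContinuousLinearMap.toSpanSingleton ℝ φ') =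
    ContinuousLinearMap.toSpanSingleton ℝ (φ' i) by ext; simp]

theorem hasDerivAt_iff_three {φ : ℝ → E3} {φ' : E3} {t : ℝ} :
    HasDerivAt φ φ' t ↔ HasDerivAt (fun s => φ s 0) (φ' 0) t ∧
      HasDerivAt (fun s => φ s 1) (φ' 1) t ∧ HasDerivAt (fun s => φ s 2) (φ' 2) t := by
  rw [hasDerivAt_iff_coord]
  simp [Fin.forall_fin_succ]

theorem norm_sq_eq (v : E3) : ‖v‖ ^ 2 = v 0 ^ 2 + v 1 ^ 2 + v 2 ^ 2 := by
  simp [EuclideanSpace.norm_sq_eq, Fin.sum_univ_three]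

theorem hasDerivAt_structureField_iff {φ : ℝ → E3} {t : ℝ} :
    HasDerivAt φ (structureField (φ t)) t ↔
      HasDerivAt (fun s => φ s 0) (φ t 0 * φ t 2) t ∧
      HasDerivAt (fun s => φ s 1) (-(φ t 1 * φ t 2)) t ∧
      HasDerivAt (fun s => φ s 2) (-(φ t 0) ^ 2 + (φ t 1) ^ 2) t := by
  rw [hasDerivAt_iff_three]
  simp [structureField]

theorem eq_of_hasDerivAt_zero {g : ℝ → ℝ} (hg : ∀ t, HasDerivAt g 0 t) (s t : ℝ) : g s = g t :=
  is_const_of_deriv_eq_zero (fun x => (hg x).differentiableAt) (fun x => (hg x).deriv) s t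

theorem IsFlowFrom.norm_eq {φ : ℝ → E3} {u : E3} (h : IsFlowFrom φ u) (t : ℝ) : ‖φ t‖ = ‖u‖ := by
  have key : ∀ s, HasDerivAt (fun s => φ s 0 ^ 2 + φ s 1 ^ 2 + φ s 2 ^ 2) 0 s := by
    intro s
    obtain ⟨h0, h1, h2⟩ := hasDerivAt_structureField_iff.1 (h.2 s)
    refine (((h0.pow 2).add (h1.pow 2)).add (h2.pow 2)).congr_deriv ?_
    push_cast
    ring
  have := eq_of_hasDerivAt_zero key t 0
  simp only [← norm_sq_eq, h.1] at this
  exact (sq_eq_sq₀ (norm_nonneg _) (norm_nonneg _)).1 this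

theorem contDiff_structureField : ContDiff ℝ 1 structureField := by
  rw [contDiff_euclidean]
  have h : ∀ j : Fin 3, ContDiff ℝ 1 fun x : E3 => x j := fun j =>
    (EuclideanSpace.proj j : E3 →L[ℝ] ℝ).contDiff
  intro i
  fin_cases i <;> simp only [structureField, Fin.zero_eta, Fin.mk_one, Fin.reduceFinMk,
    Matrix.cons_val]
  · exact (h 0).mul (h 2)
  · exact ((h 1).mul (h 2)).neg
  · exact ((h 0).pow 2).neg.add ((h 1).pow 2)

theorem lipschitzOnWith_structureField (r : ℝ) :
    ∃ K, LipschitzOnWith K structureField (Metric.closedBall 0 r) := by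
  obtain ⟨C, hC⟩ := (isCompact_closedBall (0 : E3) r).exists_bound_of_continuousOn
    (contDiff_structureField.continuous_fderiv one_ne_zero).continuousOn
  refine ⟨C.toNNReal, (convex_closedBall (0 : E3) r).lipschitzOnWith_of_nnnorm_fderiv_le
    (fun x _ => (contDiff_structureField.differentiable one_ne_zero) x) fun x hx => ?_⟩
  rw [← NNReal.coe_le_coe, coe_nnnorm]
  exact (hC x hx).trans (Real.le_coe_toNNReal C)

theorem IsFlowFrom.unique {φ ψ : ℝ → E3} {u : E3} (hφ : IsFlowFrom φ u) (hψ : IsFlowFrom ψ u) :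
    φ = ψ := by
  obtain ⟨K, hK⟩ := lipschitzOnWith_structureField ‖u‖
  refine ODE_solution_unique_univ (v := fun _ => structureField)
    (s := fun _ => Metric.closedBall 0 ‖u‖) (K := K) (t₀ := 0) (fun _ => hK) (fun t => ⟨hφ.2 t, ?_⟩)
    (fun t => ⟨hψ.2 t, ?_⟩) (by rw [hφ.1, hψ.1])
  · simp [hφ.norm_eq]
  · simp [hψ.norm_eq]

theorem IsFlowFrom.smul {φ : ℝ → E3} {u : E3} (h : IsFlowFrom φ u) (T : ℝ) :
    IsFlowFrom (fun t => T • φ (T * t)) (T • u) := by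
  refine ⟨by simp [h.1], fun t => ?_⟩
  have hd : HasDerivAt (fun t => T * t) T t := by simpa using (hasDerivAt_id t).const_mul T
  refine (((h.2 (T * t)).scomp t hd).const_smul T).congr_deriv ?_
  ext i
  fin_cases i <;> simp [structureField] <;> ring

/-! ### Geodesics of Sol -/

theorem solMetric_inv (p : E3) : (solMetric p)⁻¹ =
    Matrix.diagonal ![Real.exp (2 * p 2), Real.exp (-2 * p 2), 1] := by
  apply Matrix.inv_eq_right_inv
  rw [solMetric, Matrix.diagonal_mul_diagonal, ← Matrix.diagonal_one]
  congr 1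
  ext i
  fin_cases i <;> simp [← Real.exp_add]

theorem partialDeriv_exp (i : Fin 3) (c : ℝ) (p : E3) :
    partialDeriv i (fun q => Real.exp (c * q 2)) p =
      if i = 2 then c * Real.exp (c * p 2) else 0 := by
  have h : HasFDerivAt (fun q : E3 => Real.exp (c * q 2))
      (Real.exp (c * p 2) • (c • (EuclideanSpace.proj 2 : E3 →L[ℝ] ℝ))) p :=
    (((EuclideanSpace.proj 2 : E3 →L[ℝ] ℝ).hasFDerivAt).const_mul c).exp
  rw [partialDeriv, h.fderiv]
  fin_cases i <;> simp [mul_comm]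

theorem partialDeriv_solMetric (l i j : Fin 3) (p : E3) :
    partialDeriv l (fun q => solMetric q i j) p = if l = 2 ∧ i = j then
      ![-2 * Real.exp (-2 * p 2), 2 * Real.exp (2 * p 2), 0] i else 0 := by
  have hc : ∀ c : ℝ, partialDeriv l (fun _ => c) p = 0 := fun c => by simp [partialDeriv]
  simp only [solMetric, Matrix.diagonal_apply]
  fin_cases i <;> fin_cases j <;>
    simp only [Fin.zero_eta, Fin.mk_one, Fin.reduceFinMk, Fin.isValue, Fin.reduceEq, if_true,
      if_false, Matrix.cons_val, partialDeriv_exp, hc, and_true, and_false, ite_self]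

/-- The right-hand side of the geodesic equation of Sol, with the Christoffel symbols evaluated. -/
theorem geodesic_acceleration (p v : E3) :
    (WithLp.toLp 2 fun k => -∑ i, ∑ j, christoffel k i j p * v i * v j : E3) =
      !₂[2 * v 0 * v 2, -(2 * v 1 * v 2),
        -(Real.exp (-2 * p 2) * v 0 ^ 2) + Real.exp (2 * p 2) * v 1 ^ 2] := by
  have e : Real.exp (2 * p 2) * Real.exp (-2 * p 2) = 1 := by simp [← Real.exp_add]
  ext k
  simp only [christoffel, solMetric_inv, partialDeriv_solMetric, Fin.sum_univ_three,
    Matrix.diagonal_apply]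
  generalize Real.exp (2 * p 2) = A at *
  generalize Real.exp (-2 * p 2) = B at *
  fin_cases k <;> simp
  · linear_combination (2 * v 0 * v 2) * e
  · linear_combination (-2 * v 1 * v 2) * e
  · ring

/-- A geodesic of Sol with velocity `v`, read in the left-invariant orthonormal frame
`e^z ∂x, e^{-z} ∂y, ∂z`, is an integral curve of the structure field. -/
theorem isFlowFrom_frame {γ v : ℝ → E3} (hγ : ∀ t, HasDerivAt γ (v t) t)
    (hv : ∀ t, HasDerivAt v
      (WithLp.toLp 2 fun k => -∑ i, ∑ j, christoffel k i j (γ t) * v t i * v t j) t)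
    (h0 : γ 0 = 0) :
    IsFlowFrom (fun t => !₂[Real.exp (-γ t 2) * v t 0, Real.exp (γ t 2) * v t 1, v t 2]) (v 0) := by
  refine ⟨?_, fun t => ?_⟩
  · ext i
    fin_cases i <;> simp [h0]
  · have hz := (hasDerivAt_iff_three.1 (hγ t)).2.2
    have hv' := hv t
    rw [geodesic_acceleration, hasDerivAt_iff_three] at hv'
    obtain ⟨a0, a1, a2⟩ := hv'
    simp only [Matrix.cons_val] at a0 a1 a2
    have e1 : Real.exp (-2 * γ t 2) = Real.exp (-γ t 2) ^ 2 := by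
      rw [← Real.exp_nat_mul]; congr 1; push_cast; ring
    have e2 : Real.exp (2 * γ t 2) = Real.exp (γ t 2) ^ 2 := by
      rw [← Real.exp_nat_mul]; congr 1
    rw [hasDerivAt_structureField_iff (φ := fun t =>
      (!₂[Real.exp (-γ t 2) * v t 0, Real.exp (γ t 2) * v t 1, v t 2] : E3))]
    simp only [Matrix.cons_val]
    refine ⟨(hz.neg.exp.mul a0).congr_deriv (by simp only [Pi.neg_apply]; ring),
      (hz.exp.mul a1).congr_deriv (by ring), a2.congr_deriv ?_⟩
    rw [e1, e2]
    ring

theorem eq_of_hasDerivAt_eq {f g f' : ℝ → ℝ} (hf : ∀ t, HasDerivAt f (f' t) t)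
    (hg : ∀ t, HasDerivAt g (f' t) t) {s : ℝ} (h0 : f s = g s) : f = g := by
  funext t
  have := eq_of_hasDerivAt_zero (g := fun t => f t - g t)
    (fun t => ((hf t).sub (hg t)).congr_deriv (sub_self _)) t s
  linarith

/-- The exponential map is obtained by integrating the reconstruction equations
`x' = e^z u₀`, `y' = e^{-z} u₁`, `z' = u₂` along the flowline `u` of the structure field. -/
theorem solExp_smul {φ : ℝ → E3} {u : E3} (hφ : IsFlowFrom φ u) {X Y Z : ℝ → ℝ}
    (hX : ∀ t, HasDerivAt X (Real.exp (Z t) * φ t 0) t)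
    (hY : ∀ t, HasDerivAt Y (Real.exp (-Z t) * φ t 1) t)
    (hZ : ∀ t, HasDerivAt Z (φ t 2) t) (X0 : X 0 = 0) (Y0 : Y 0 = 0) (Z0 : Z 0 = 0) (T : ℝ) :
    solExp (T • u) = !₂[X T, Y T, Z T] := by
  have hd : ∀ t, HasDerivAt (fun t => T * t) T t := fun t => by
    simpa using (hasDerivAt_id t).const_mul T
  have hX' : ∀ t, HasDerivAt (fun t => X (T * t)) (Real.exp (Z (T * t)) * (T * φ (T * t) 0)) t :=
    fun t => ((hX (T * t)).comp t (hd t)).congr_deriv (by ring)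
  have hY' : ∀ t, HasDerivAt (fun t => Y (T * t)) (Real.exp (-Z (T * t)) * (T * φ (T * t) 1)) t :=
    fun t => ((hY (T * t)).comp t (hd t)).congr_deriv (by ring)
  have hZ' : ∀ t, HasDerivAt (fun t => Z (T * t)) (T * φ (T * t) 2) t :=
    fun t => ((hZ (T * t)).comp t (hd t)).congr_deriv (by ring)
  have hu := hφ.smul T
  have hex : ∃ γ : ℝ → E3, IsGeodesic γ ∧ γ 0 = 0 ∧ HasDerivAt γ (T • u) 0 := by
    set γ : ℝ → E3 := fun t => !₂[X (T * t), Y (T * t), Z (T * t)] with hγ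
    set v : ℝ → E3 := fun t => !₂[Real.exp (Z (T * t)) * (T * φ (T * t) 0),
      Real.exp (-Z (T * t)) * (T * φ (T * t) 1), T * φ (T * t) 2] with hv
    have hγv : ∀ t, HasDerivAt γ (v t) t := fun t => by
      rw [hasDerivAt_iff_three]
      exact ⟨hX' t, hY' t, hZ' t⟩
    refine ⟨γ, ⟨v, hγv, fun t => ?_⟩, ?_, ?_⟩
    · obtain ⟨u0, u1, u2⟩ := hasDerivAt_structureField_iff.1 (hu.2 t)
      simp only [PiLp.smul_apply, smul_eq_mul] at u0 u1 u2
      rw [geodesic_acceleration, hasDerivAt_iff_three]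
      refine ⟨((hZ' t).exp.mul u0).congr_deriv ?_, ((hZ' t).neg.exp.mul u1).congr_deriv ?_,
        u2.congr_deriv ?_⟩
      · simp [hv]; ring
      · simp [hv]; ring
      · simp only [hv, hγ, Matrix.cons_val, mul_pow, ← Real.exp_nat_mul, ← mul_assoc,
          ← Real.exp_add]
        ring_nf
        simp
    · ext i
      fin_cases i <;> simp [hγ, X0, Y0, Z0]
    · convert hγv 0 using 1
      ext i
      fin_cases i <;> simp [hv, Z0, hφ.1]
  rw [solExp, dif_pos hex]
  obtain ⟨⟨v, hγ, hv⟩, h0, hV⟩ := hex.choose_spec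
  set γ := hex.choose
  have hfr := isFlowFrom_frame hγ hv h0
  rw [(hγ 0).unique hV] at hfr
  have hEq := hfr.unique hu
  have hc : ∀ t, Real.exp (-γ t 2) * v t 0 = T * φ (T * t) 0 ∧
      Real.exp (γ t 2) * v t 1 = T * φ (T * t) 1 ∧ v t 2 = T * φ (T * t) 2 := fun t => by
    have := congrFun hEq t
    exact ⟨by simpa using congrArg (fun w : E3 => w 0) this,
      by simpa using congrArg (fun w : E3 => w 1) this,
      by simpa using congrArg (fun w : E3 => w 2) this⟩
  have hz : (fun t => γ t 2) = fun t => Z (T * t) :=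
    eq_of_hasDerivAt_eq (fun t => ((hasDerivAt_iff_three.1 (hγ t)).2.2).congr_deriv (hc t).2.2)
      hZ' (s := 0) (by simp [h0, Z0])
  have hx : (fun t => γ t 0) = fun t => X (T * t) :=
    eq_of_hasDerivAt_eq (fun t => ((hasDerivAt_iff_three.1 (hγ t)).1).congr_deriv (by
      rw [← (hc t).1, ← congrFun hz t, ← mul_assoc, ← Real.exp_add]; simp))
      hX' (s := 0) (by simp [h0, X0])
  have hy : (fun t => γ t 1) = fun t => Y (T * t) :=
    eq_of_hasDerivAt_eq (fun t => ((hasDerivAt_iff_three.1 (hγ t)).2.1).congr_deriv (by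
      rw [← (hc t).2.1, ← congrFun hz t, ← mul_assoc, ← Real.exp_add]; simp))
      hY' (s := 0) (by simp [h0, Y0])
  ext i
  fin_cases i
  · simpa using congrFun hx 1
  · simpa using congrFun hy 1
  · simpa using congrFun hz 1

/-- A coordinate `x` or `y` of a geodesic is monotone, with the sign of its initial velocity.
No existence of geodesics is needed: otherwise `solExp V` is the origin by default. -/
theorem pos_of_solExp_pos {V : E3} :
    (0 < solExp V 0 → 0 < V 0) ∧ (0 < solExp V 1 → 0 < V 1) := by
  by_cases hex : ∃ γ : ℝ → E3, IsGeodesic γ ∧ γ 0 = 0 ∧ HasDerivAt γ V 0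
  swap
  · simp [solExp, dif_neg hex]
  rw [solExp, dif_pos hex]
  obtain ⟨⟨v, hγ, hv⟩, h0, hV⟩ := hex.choose_spec
  set γ := hex.choose
  have hv0 : v 0 = V := (hγ 0).unique hV
  have hg := fun t => hasDerivAt_iff_three.1 (hγ t)
  have ha := fun t => hasDerivAt_iff_three.1 ((geodesic_acceleration (γ t) (v t)) ▸ hv t)
  simp only [Matrix.cons_val] at ha
  -- `∂x` and `∂y` are Killing fields, which gives two conserved momenta.
  have m0 : ∀ t, v t 0 = V 0 * Real.exp (2 * γ t 2) := fun t => by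
    have := eq_of_hasDerivAt_zero (g := fun t => v t 0 * Real.exp (-(2 * γ t 2)))
      (fun t => ((ha t).1.mul ((hg t).2.2.const_mul 2).neg.exp).congr_deriv (by ring)) t 0
    simp only [h0, hv0, Real.exp_neg] at this
    field_simp at this
    simpa [mul_comm] using this
  have m1 : ∀ t, v t 1 = V 1 * Real.exp (-(2 * γ t 2)) := fun t => by
    have := eq_of_hasDerivAt_zero (g := fun t => v t 1 * Real.exp (2 * γ t 2))
      (fun t => ((ha t).2.1.mul ((hg t).2.2.const_mul 2).exp).congr_deriv (by ring)) t 0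
    simp only [h0, hv0] at this
    rw [Real.exp_neg]
    field_simp
    simpa using this
  constructor
  · intro h
    by_contra! hn
    have : Antitone fun t => γ t 0 := antitone_of_hasDerivAt_nonpos (fun t => (hg t).1)
      fun t => by rw [m0]; exact mul_nonpos_of_nonpos_of_nonneg hn (Real.exp_pos _).le
    have := this (zero_le_one (α := ℝ))
    simp [h0] at this
    linarith
  · intro h
    by_contra! hn
    have : Antitone fun t => γ t 1 := antitone_of_hasDerivAt_nonpos (fun t => (hg t).2.1)
      fun t => by rw [m1]; exact mul_nonpos_of_nonpos_of_nonneg hn (Real.exp_pos _).le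
    have := this (zero_le_one (α := ℝ))
    simp [h0] at this
    linarith

/-! ### The level sets parametrized by an angle -/

/-- The maximum `√(1 - 2h)` of the coordinate `z` on the level set `xy = h` of the unit sphere. -/
noncomputable def height (h : ℝ) : ℝ := √(1 - 2 * h)

/-- The angular speed `√(4h + (1 - 2h) sin² θ)` with which the structure field runs through
the level set `xy = h` in the parametrization `orbit h`. -/
noncomputable def speed (h θ : ℝ) : ℝ := √(4 * h + (1 - 2 * h) * Real.sin θ ^ 2)

/-- The component in the region `x, y > 0` of the level set `xy = h` of the unit sphere,
parametrized by the angle `θ` of the vector `(z, x - y)`. -/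
noncomputable def orbit (h θ : ℝ) : E3 :=
  !₂[(speed h θ + height h * Real.sin θ) / 2, (speed h θ - height h * Real.sin θ) / 2,
    height h * Real.cos θ]

/-- The time that the structure field takes to run once around the level set `xy = h`. -/
noncomputable def period (h : ℝ) : ℝ := ∫ θ in (0)..(2 * Real.pi), (speed h θ)⁻¹

/-- The integral of `x²`, and also of `y²`, over one period of the level set `xy = h`. -/
noncomputable def meanSquare (h : ℝ) : ℝ :=
  ∫ θ in (0)..(2 * Real.pi), (2 * h + (1 - 2 * h) * Real.sin θ ^ 2) / (2 * speed h θ)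

section
variable {h : ℝ}

theorem height_sq (h1 : h < 1 / 2) : height h ^ 2 = 1 - 2 * h :=
  Real.sq_sqrt (by linarith)

theorem height_pos (h1 : h < 1 / 2) : 0 < height h :=
  Real.sqrt_pos.2 (by linarith)

theorem radicand_pos (h0 : 0 < h) (h1 : h < 1 / 2) (θ : ℝ) :
    0 < 4 * h + (1 - 2 * h) * Real.sin θ ^ 2 := by
  have : 0 ≤ (1 - 2 * h) * Real.sin θ ^ 2 := mul_nonneg (by linarith) (sq_nonneg _)
  linarith

theorem speed_pos (h0 : 0 < h) (h1 : h < 1 / 2) (θ : ℝ) : 0 < speed h θ :=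
  Real.sqrt_pos.2 (radicand_pos h0 h1 θ)

theorem speed_sq (h0 : 0 < h) (h1 : h < 1 / 2) (θ : ℝ) :
    speed h θ ^ 2 = 4 * h + height h ^ 2 * Real.sin θ ^ 2 := by
  rw [height_sq h1]
  exact Real.sq_sqrt (radicand_pos h0 h1 θ).le

theorem hasDerivAt_speed (h0 : 0 < h) (h1 : h < 1 / 2) (θ : ℝ) :
    HasDerivAt (speed h) (height h ^ 2 * Real.sin θ * Real.cos θ / speed h θ) θ := by
  refine (((((Real.hasDerivAt_sin θ).pow 2).const_mul (1 - 2 * h)).const_add (4 * h)).sqrt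
    (radicand_pos h0 h1 θ).ne').congr_deriv ?_
  rw [height_sq h1, speed]
  push_cast
  simp only [Pi.pow_apply]
  field_simp

theorem continuous_speed (h0 : 0 < h) (h1 : h < 1 / 2) : Continuous (speed h) :=
  continuous_iff_continuousAt.2 fun θ => (hasDerivAt_speed h0 h1 θ).continuousAt

theorem continuous_inv_speed (h0 : 0 < h) (h1 : h < 1 / 2) :
    Continuous fun θ => (speed h θ)⁻¹ :=
  (continuous_speed h0 h1).inv₀ fun θ => (speed_pos h0 h1 θ).ne'

theorem speed_periodic : Function.Periodic (speed h) (2 * Real.pi) := fun θ => by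
  simp [speed]

theorem speed_le_two (h0 : 0 < h) (h1 : h < 1 / 2) (θ : ℝ) : speed h θ ≤ 2 := by
  rw [speed, Real.sqrt_le_left two_pos.le]
  nlinarith [Real.sin_sq_le_one θ]

theorem hasDerivAt_time (h0 : 0 < h) (h1 : h < 1 / 2) (θ₀ θ : ℝ) :
    HasDerivAt (fun x => ∫ y in θ₀..x, (speed h y)⁻¹) (speed h θ)⁻¹ θ :=
  ((continuous_inv_speed h0 h1).integral_hasStrictDerivAt θ₀ θ).hasDerivAt

/-- The autonomous equation `θ' = speed h θ`, solved by inverting the time `∫ dθ / speed h θ`. -/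
theorem exists_angle (h0 : 0 < h) (h1 : h < 1 / 2) (θ₀ : ℝ) :
    ∃ θ : ℝ → ℝ, θ 0 = θ₀ ∧ (∀ t, HasDerivAt θ (speed h (θ t)) t) ∧ StrictMono θ ∧
      ∀ x, θ (∫ y in θ₀..x, (speed h y)⁻¹) = x := by
  set τ : ℝ → ℝ := fun x => ∫ y in θ₀..x, (speed h y)⁻¹ with hτ
  have hd : ∀ x, HasDerivAt τ (speed h x)⁻¹ x := hasDerivAt_time h0 h1 θ₀
  have hmono : StrictMono τ := strictMono_of_hasDerivAt_pos hd
    fun x => inv_pos.2 (speed_pos h0 h1 x)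
  have hcont : Continuous τ := continuous_iff_continuousAt.2 fun x => (hd x).continuousAt
  have hlin : Monotone fun x => τ x - 1 / 2 * x := by
    refine monotone_of_hasDerivAt_nonneg
      (fun x => (hd x).sub ((hasDerivAt_id x).const_mul (1 / 2))) fun x => ?_
    have := inv_anti₀ (speed_pos h0 h1 x) (speed_le_two h0 h1 x)
    simp only [Pi.zero_apply]
    linarith
  have htop : Filter.Tendsto τ Filter.atTop Filter.atTop := by
    refine Filter.tendsto_atTop_mono' _ ?_ (Filter.tendsto_atTop_add_const_left _
      (τ 0 - 1 / 2 * 0) (Filter.tendsto_id.const_mul_atTop (half_pos one_pos)))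
    filter_upwards [Filter.eventually_ge_atTop 0] with x hx
    have := hlin hx
    simp only [id] at *
    linarith
  have hbot : Filter.Tendsto τ Filter.atBot Filter.atBot := by
    refine Filter.tendsto_atBot_mono' _ ?_ (Filter.tendsto_atBot_add_const_left _
      (τ 0 - 1 / 2 * 0) (Filter.tendsto_id.const_mul_atBot (half_pos one_pos)))
    filter_upwards [Filter.eventually_le_atBot 0] with x hx
    have := hlin hx
    simp only [id] at *
    linarith
  set e := hmono.orderIsoOfSurjective τ (hcont.surjective htop hbot)
  have he : ∀ x, e.symm (τ x) = x := fun x => e.symm_apply_apply x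
  have he' : ∀ t, τ (e.symm t) = t := fun t => e.apply_symm_apply t
  refine ⟨e.symm, ?_, fun t => ?_, e.symm.strictMono, he⟩
  · simpa [hτ] using he θ₀
  · have := HasDerivAt.of_local_left_inverse (f := τ) (g := e.symm) (a := t)
      e.symm.continuous.continuousAt (hd (e.symm t)) (inv_pos.2 (speed_pos h0 h1 _)).ne'
      (Filter.Eventually.of_forall he')
    simpa using this

theorem orbit_pos (h0 : 0 < h) (h1 : h < 1 / 2) (θ : ℝ) :
    0 < orbit h θ 0 ∧ 0 < orbit h θ 1 := by
  have := abs_lt_of_sq_lt_sq (a := height h * Real.sin θ) (b := speed h θ)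
    (by rw [speed_sq h0 h1]; linarith) (speed_pos h0 h1 θ).le
  rw [abs_lt] at this
  simp only [orbit, Matrix.cons_val]
  constructor <;> linarith

theorem orbit_mul (h0 : 0 < h) (h1 : h < 1 / 2) (θ : ℝ) : orbit h θ 0 * orbit h θ 1 = h := by
  simp only [orbit, Matrix.cons_val]
  linear_combination (1 / 4) * speed_sq h0 h1 θ

theorem isFlowFrom_orbit (h0 : 0 < h) (h1 : h < 1 / 2) {θ : ℝ → ℝ}
    (hθ : ∀ t, HasDerivAt θ (speed h (θ t)) t) :
    IsFlowFrom (fun t => orbit h (θ t)) (orbit h (θ 0)) := by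
  refine ⟨rfl, fun t => ?_⟩
  rw [hasDerivAt_structureField_iff (φ := fun t => orbit h (θ t))]
  have hs := (hasDerivAt_speed h0 h1 (θ t)).comp t (hθ t)
  have hsin := ((hθ t).sin).const_mul (height h)
  have hcos := ((hθ t).cos).const_mul (height h)
  have hne := (speed_pos h0 h1 (θ t)).ne'
  simp only [orbit, Matrix.cons_val]
  refine ⟨((hs.add hsin).div_const 2).congr_deriv ?_, ((hs.sub hsin).div_const 2).congr_deriv ?_,
    hcos.congr_deriv ?_⟩
  · field_simp
    ring
  · field_simp
    ring
  · ring

theorem exists_orbit_eq {v : E3} (hv : ‖v‖ = 1) (v0 : 0 < v 0) (v1 : 0 < v 1)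
    (h1 : v 0 * v 1 < 1 / 2) : ∃ θ ∈ Set.Ioc (-Real.pi) Real.pi,
      orbit (v 0 * v 1) θ = v := by
  have hsq := norm_sq_eq v
  rw [hv] at hsq
  have hp := height_pos h1
  have hp2 := height_sq h1
  set p := height (v 0 * v 1)
  have hc : (v 2 / p) ^ 2 + ((v 0 - v 1) / p) ^ 2 = 1 := by
    field_simp
    linarith
  obtain ⟨θ, hθ, hθc, hθs⟩ : ∃ θ ∈ Set.Ioc (-Real.pi) Real.pi,
      Real.cos θ = v 2 / p ∧ Real.sin θ = (v 0 - v 1) / p := by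
    have hn : ‖(⟨v 2 / p, (v 0 - v 1) / p⟩ : ℂ)‖ = 1 := by
      rw [← sq_eq_sq₀ (norm_nonneg _) zero_le_one, ← Complex.normSq_eq_norm_sq,
        Complex.normSq_apply]
      linarith
    refine ⟨Complex.arg ⟨v 2 / p, (v 0 - v 1) / p⟩, Complex.arg_mem_Ioc _, ?_, ?_⟩
    · rw [Complex.cos_arg (norm_ne_zero_iff.1 (by rw [hn]; exact one_ne_zero)), hn]
      simp
    · rw [Complex.sin_arg, hn]
      simp
  have hs : speed (v 0 * v 1) θ = v 0 + v 1 := by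
    rw [← sq_eq_sq₀ (speed_pos (mul_pos v0 v1) h1 θ).le (by positivity),
      speed_sq (mul_pos v0 v1) h1, hθs]
    change _ + p ^ 2 * _ = _
    field_simp
    ring
  refine ⟨θ, hθ, ?_⟩
  ext i
  fin_cases i <;> simp only [orbit, Fin.zero_eta, Fin.mk_one, Fin.reduceFinMk, Matrix.cons_val,
    hs, hθs, hθc] <;> field_simp <;> ring

theorem norm_orbit (h0 : 0 < h) (h1 : h < 1 / 2) (θ : ℝ) : ‖orbit h θ‖ = 1 := by
  rw [← sq_eq_sq₀ (norm_nonneg _) zero_le_one, norm_sq_eq]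
  simp only [orbit, Matrix.cons_val]
  linear_combination (1 / 2) * speed_sq h0 h1 θ + height_sq h1 +
    height h ^ 2 * Real.sin_sq_add_cos_sq θ

end

/-! ### The exponential map along an orbit -/

section
variable {h : ℝ}

theorem orbit_zero_sq_div (h0 : 0 < h) (h1 : h < 1 / 2) (θ : ℝ) :
    orbit h θ 0 ^ 2 / speed h θ =
      (2 * h + (1 - 2 * h) * Real.sin θ ^ 2) / (2 * speed h θ) + height h / 2 * Real.sin θ := by
  have hs := (speed_pos h0 h1 θ).ne'
  have hq := speed_sq h0 h1 θ
  simp only [orbit, Matrix.cons_val, ← height_sq h1]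
  field_simp
  linear_combination hq

theorem orbit_one_sq_div (h0 : 0 < h) (h1 : h < 1 / 2) (θ : ℝ) :
    orbit h θ 1 ^ 2 / speed h θ =
      (2 * h + (1 - 2 * h) * Real.sin θ ^ 2) / (2 * speed h θ) - height h / 2 * Real.sin θ := by
  have hs := (speed_pos h0 h1 θ).ne'
  have hq := speed_sq h0 h1 θ
  simp only [orbit, Matrix.cons_val, ← height_sq h1]
  field_simp
  linear_combination hq

theorem continuous_meanSquare_integrand (h0 : 0 < h) (h1 : h < 1 / 2) :
    Continuous fun θ => (2 * h + (1 - 2 * h) * Real.sin θ ^ 2) / (2 * speed h θ) :=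
  Continuous.div (by fun_prop) ((continuous_speed h0 h1).const_mul 2)
    fun θ => (mul_pos two_pos (speed_pos h0 h1 θ)).ne'

theorem continuous_orbit_zero_sq_div (h0 : 0 < h) (h1 : h < 1 / 2) :
    Continuous fun θ => orbit h θ 0 ^ 2 / speed h θ := by
  simp only [orbit_zero_sq_div h0 h1]
  exact (continuous_meanSquare_integrand h0 h1).add (by fun_prop)

theorem continuous_orbit_one_sq_div (h0 : 0 < h) (h1 : h < 1 / 2) :
    Continuous fun θ => orbit h θ 1 ^ 2 / speed h θ := by
  simp only [orbit_one_sq_div h0 h1]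
  exact (continuous_meanSquare_integrand h0 h1).sub (by fun_prop)

theorem integral_orbit_zero_sq (h0 : 0 < h) (h1 : h < 1 / 2) (θ₀ : ℝ) :
    ∫ θ in θ₀..(θ₀ + 2 * Real.pi), orbit h θ 0 ^ 2 / speed h θ = meanSquare h := by
  have hp : Function.Periodic (fun θ => orbit h θ 0 ^ 2 / speed h θ) (2 * Real.pi) := fun θ => by
    simp [orbit, speed_periodic θ]
  rw [hp.intervalIntegral_add_eq θ₀ 0, zero_add]
  simp only [orbit_zero_sq_div h0 h1]
  rw [intervalIntegral.integral_add
    ((continuous_meanSquare_integrand h0 h1).intervalIntegrable _ _)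
    (Continuous.intervalIntegrable (by fun_prop) _ _), intervalIntegral.integral_const_mul,
    integral_sin, meanSquare]
  simp

theorem integral_orbit_one_sq (h0 : 0 < h) (h1 : h < 1 / 2) (θ₀ : ℝ) :
    ∫ θ in θ₀..(θ₀ + 2 * Real.pi), orbit h θ 1 ^ 2 / speed h θ = meanSquare h := by
  have hp : Function.Periodic (fun θ => orbit h θ 1 ^ 2 / speed h θ) (2 * Real.pi) := fun θ => by
    simp [orbit, speed_periodic θ]
  rw [hp.intervalIntegral_add_eq θ₀ 0, zero_add]
  simp only [orbit_one_sq_div h0 h1]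
  rw [intervalIntegral.integral_sub
    ((continuous_meanSquare_integrand h0 h1).intervalIntegrable _ _)
    (Continuous.intervalIntegrable (by fun_prop) _ _), intervalIntegral.integral_const_mul,
    integral_sin, meanSquare]
  simp

theorem integral_inv_speed (θ₀ : ℝ) :
    ∫ θ in θ₀..(θ₀ + 2 * Real.pi), (speed h θ)⁻¹ = period h := by
  have hp : Function.Periodic (fun θ => (speed h θ)⁻¹) (2 * Real.pi) := fun θ => by
    simp [speed_periodic θ]
  rw [hp.intervalIntegral_add_eq θ₀ 0, zero_add, period]

theorem period_pos (h0 : 0 < h) (h1 : h < 1 / 2) : 0 < period h :=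
  intervalIntegral.intervalIntegral_pos_of_pos
    ((continuous_inv_speed h0 h1).intervalIntegrable _ _)
    (fun θ => inv_pos.2 (speed_pos h0 h1 θ)) Real.two_pi_pos

/-- The exponential map in closed form: since `e^z` is proportional to the first frame coordinate,
the coordinates `x` and `y` of the geodesic are integrals of squares along the orbit. -/
theorem solExp_smul_orbit (h0 : 0 < h) (h1 : h < 1 / 2) {θ : ℝ → ℝ}
    (hθ : ∀ t, HasDerivAt θ (speed h (θ t)) t) (T : ℝ) :
    solExp (T • orbit h (θ 0)) =
      !₂[(∫ x in θ 0..θ T, orbit h x 0 ^ 2 / speed h x) / orbit h (θ 0) 0,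
        (∫ x in θ 0..θ T, orbit h x 1 ^ 2 / speed h x) / orbit h (θ 0) 1,
        Real.log (orbit h (θ T) 0 / orbit h (θ 0) 0)] := by
  have hφ := isFlowFrom_orbit h0 h1 hθ
  have hpos := fun t => orbit_pos h0 h1 (θ t)
  have hm := fun t => orbit_mul h0 h1 (θ t)
  have hX : ∀ t, HasDerivAt (fun t => ∫ x in θ 0..θ t, orbit h x 0 ^ 2 / speed h x)
      (orbit h (θ t) 0 ^ 2) t := fun t => by
    refine ((((continuous_orbit_zero_sq_div h0 h1).integral_hasStrictDerivAt
      (θ 0) (θ t)).hasDerivAt).comp t (hθ t)).congr_deriv ?_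
    exact div_mul_cancel₀ _ (speed_pos h0 h1 _).ne'
  have hY : ∀ t, HasDerivAt (fun t => ∫ x in θ 0..θ t, orbit h x 1 ^ 2 / speed h x)
      (orbit h (θ t) 1 ^ 2) t := fun t => by
    refine ((((continuous_orbit_one_sq_div h0 h1).integral_hasStrictDerivAt
      (θ 0) (θ t)).hasDerivAt).comp t (hθ t)).congr_deriv ?_
    exact div_mul_cancel₀ _ (speed_pos h0 h1 _).ne'
  have hex : ∀ t, Real.exp (Real.log (orbit h (θ t) 0 / orbit h (θ 0) 0)) =
      orbit h (θ t) 0 / orbit h (θ 0) 0 := fun t =>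
    Real.exp_log (div_pos (hpos t).1 (hpos 0).1)
  refine solExp_smul hφ
    (X := fun t => (∫ x in θ 0..θ t, orbit h x 0 ^ 2 / speed h x) / orbit h (θ 0) 0)
    (Y := fun t => (∫ x in θ 0..θ t, orbit h x 1 ^ 2 / speed h x) / orbit h (θ 0) 1)
    (Z := fun t => Real.log (orbit h (θ t) 0 / orbit h (θ 0) 0))
    (fun t => ((hX t).div_const _).congr_deriv ?_) (fun t => ((hY t).div_const _).congr_deriv ?_)
    (fun t => ?_) (by simp) (by simp) (by simp [(hpos 0).1.ne']) T
  · rw [hex]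
    ring
  · rw [Real.exp_neg, hex, inv_div, div_mul_eq_mul_div, div_eq_div_iff (hpos 0).2.ne' (hpos t).1.ne']
    linear_combination orbit h (θ t) 1 * (hm t - hm 0)
  · refine (((hasDerivAt_structureField_iff.1 (hφ.2 t)).1.div_const _).log
      (div_pos (hpos t).1 (hpos 0).1).ne').congr_deriv ?_
    have := (hpos 0).1.ne'
    have := (hpos t).1.ne'
    field_simp

theorem orbit_periodic (θ : ℝ) : orbit h (θ + 2 * Real.pi) = orbit h θ := by
  simp [orbit, speed_periodic θ]

theorem sin_cos_of_orbit {θ : ℝ} {w : E3} (hw : orbit h θ = w) :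
    height h * Real.sin θ = w 0 - w 1 ∧ height h * Real.cos θ = w 2 := by
  subst hw
  simp only [orbit, Matrix.cons_val, and_true]
  ring

/-- The flow through `orbit h θ₀` first returns when the angle has grown by `2π`. -/
theorem inLoopLevelSet_orbit (h0 : 0 < h) (h1 : h < 1 / 2) {θ₀ L : ℝ} :
    InLoopLevelSet (orbit h θ₀) L ↔ L = period h := by
  obtain ⟨θ, hθ0, hθ, hmono, hinv⟩ := exists_angle h0 h1 θ₀
  have hφ := isFlowFrom_orbit h0 h1 hθ
  have hper : θ (period h) = θ₀ + 2 * Real.pi := by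
    rw [← integral_inv_speed θ₀, hinv]
  rw [hθ0] at hφ
  have hleast : IsLeast {T : ℝ | 0 < T ∧ orbit h (θ T) = orbit h θ₀} (period h) := by
    refine ⟨⟨period_pos h0 h1, by rw [hper, orbit_periodic]⟩, ?_⟩
    rintro T ⟨hT, hT'⟩
    by_contra! hlt
    have ha := hmono hT
    have hb := hmono hlt
    rw [hθ0] at ha
    rw [hper] at hb
    obtain ⟨s1, c1⟩ := sin_cos_of_orbit hT'
    obtain ⟨s2, c2⟩ := sin_cos_of_orbit (rfl : orbit h θ₀ = _)
    have hp := (height_pos h1).ne'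
    have hs := mul_left_cancel₀ hp (s1.trans s2.symm)
    have hc := mul_left_cancel₀ hp (c1.trans c2.symm)
    have hone : Real.cos (θ T - θ₀) = 1 := by
      rw [Real.cos_sub, hs, hc]
      linarith [Real.sin_sq_add_cos_sq θ₀]
    rw [Real.cos_eq_one_iff_of_lt_of_lt (by linarith [Real.pi_pos]) (by linarith)] at hone
    linarith
  constructor
  · rintro ⟨-, φ, hφ', hL⟩
    rw [hφ'.unique hφ] at hL
    exact hL.unique hleast
  · rintro rfl
    exact ⟨norm_orbit h0 h1 θ₀, _, hφ, hleast⟩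

/-! ### Estimates of the period and of the mean square -/

theorem abs_sin_le_speed (h0 : 0 < h) (h1 : h < 1 / 2) (θ : ℝ) :
    height h * |Real.sin θ| ≤ speed h θ := by
  refine Real.le_sqrt_of_sq_le ?_
  rw [mul_pow, sq_abs, height_sq h1]
  linarith

/-- `∫ dθ / (a² cos² θ + b² sin² θ)` through a global antiderivative. -/
theorem integral_inv_sq_combination {a b : ℝ} (ha : 0 < a) (hb : 0 < b) :
    ∫ θ in (0)..(2 * Real.pi), (a ^ 2 * Real.cos θ ^ 2 + b ^ 2 * Real.sin θ ^ 2)⁻¹ =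
      2 * Real.pi / (a * b) := by
  have hpos : ∀ c d : ℝ, 0 < c → 0 < d → ∀ θ : ℝ,
      0 < c * Real.cos θ ^ 2 + d * Real.sin θ ^ 2 := fun c d hc hd θ => by
    rcases le_total (Real.cos θ ^ 2) (1 / 2) with hθ | hθ
    · have := mul_nonneg hc.le (sq_nonneg (Real.cos θ))
      have := mul_pos hd (show 0 < Real.sin θ ^ 2 by linarith [Real.sin_sq_add_cos_sq θ])
      linarith
    · have := mul_nonneg hd.le (sq_nonneg (Real.sin θ))
      have := mul_pos hc (show 0 < Real.cos θ ^ 2 by linarith)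
      linarith
  have key : ∀ θ : ℝ, HasDerivAt (fun x => (x + Real.arctan ((b - a) * (Real.sin x * Real.cos x) /
      (a * Real.cos x ^ 2 + b * Real.sin x ^ 2))) / (a * b))
      (a ^ 2 * Real.cos θ ^ 2 + b ^ 2 * Real.sin θ ^ 2)⁻¹ θ := fun θ => by
    have hD := (hpos a b ha hb θ).ne'
    have hQ := (hpos (a ^ 2) (b ^ 2) (by positivity) (by positivity) θ).ne'
    have hs := Real.hasDerivAt_sin θ
    have hc := Real.hasDerivAt_cos θ
    have hq := (((hs.mul hc).const_mul (b - a)).div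
      (((hc.pow 2).const_mul a).add ((hs.pow 2).const_mul b)) hD).arctan
    refine (((hasDerivAt_id θ).add hq).div_const (a * b)).congr_deriv ?_
    simp only [Pi.mul_apply, Pi.add_apply, Pi.pow_apply, Pi.div_apply]
    have hsc := Real.sin_sq_add_cos_sq θ
    generalize Real.sin θ = s at *
    generalize Real.cos θ = c at *
    have e : 1 + ((b - a) * (s * c) / (a * c ^ 2 + b * s ^ 2)) ^ 2 =
        (a ^ 2 * c ^ 2 + b ^ 2 * s ^ 2) / (a * c ^ 2 + b * s ^ 2) ^ 2 := by
      field_simp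
      linear_combination (a ^ 2 * c ^ 2 + b ^ 2 * s ^ 2) * hsc
    rw [e]
    push_cast
    field_simp
    linear_combination ((b - a) * (a * c ^ 2 - b * s ^ 2) + a * b) * hsc
  rw [intervalIntegral.integral_eq_sub_of_hasDerivAt (fun θ _ => key θ)
    (Continuous.intervalIntegrable (Continuous.inv₀ (by fun_prop) fun θ =>
      (hpos (a ^ 2) (b ^ 2) (by positivity) (by positivity) θ).ne') _ _)]
  simp

/-- The period grows at most like `h ^ (-1/4)`. The logarithmic growth is not needed: `√h` times
the period tends to `0` as the period tends to infinity. -/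
theorem period_mul_le (h0 : 0 < h) (h1 : h < 1 / 2) : period h * √√h ≤ 5 := by
  set l := √√h with hl
  have hlpos : 0 < l := Real.sqrt_pos.2 (Real.sqrt_pos.2 h0)
  have hl2 : l ^ 2 = √h := Real.sq_sqrt (Real.sqrt_nonneg h)
  have hl4 : h = (l ^ 2) ^ 2 := by rw [hl2, Real.sq_sqrt h0.le]
  set b := √(1 + 2 * h) with hb
  have hb2 : b ^ 2 = 1 + 2 * h := Real.sq_sqrt (by linarith)
  have hb1 : 1 ≤ b := Real.one_le_sqrt.2 (by linarith)
  have hf : ∀ θ, speed h θ ^ 2 =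
      (2 * l ^ 2) ^ 2 * Real.cos θ ^ 2 + b ^ 2 * Real.sin θ ^ 2 := fun θ => by
    rw [speed_sq h0 h1, height_sq h1, hb2]
    linear_combination 4 * Real.cos θ ^ 2 * hl4 - 4 * h * Real.sin_sq_add_cos_sq θ
  -- The arithmetic-geometric mean inequality `1/f ≤ (l/f² + 1/l)/2` with the optimal weight.
  have hle : ∀ θ, (speed h θ)⁻¹ ≤ l / 2 * ((2 * l ^ 2) ^ 2 * Real.cos θ ^ 2 +
      b ^ 2 * Real.sin θ ^ 2)⁻¹ + 1 / (2 * l) := fun θ => by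
    have hs := speed_pos h0 h1 θ
    rw [← hf]
    field_simp
    nlinarith [sq_nonneg (speed h θ - l)]
  have hci : Continuous fun θ => ((2 * l ^ 2) ^ 2 * Real.cos θ ^ 2 + b ^ 2 * Real.sin θ ^ 2)⁻¹ := by
    simp only [← hf]
    exact ((continuous_speed h0 h1).pow 2).inv₀ fun θ => (pow_pos (speed_pos h0 h1 θ) 2).ne'
  have hint : period h ≤ l / 2 * (2 * Real.pi / (2 * l ^ 2 * b)) +
      2 * Real.pi * (1 / (2 * l)) := by
    have := intervalIntegral.integral_mono_on (μ := MeasureTheory.volume) (a := 0)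
      (b := 2 * Real.pi) Real.two_pi_pos.le
      ((continuous_inv_speed h0 h1).intervalIntegrable _ _)
      (((hci.const_mul (l / 2)).add
        (continuous_const (y := 1 / (2 * l)))).intervalIntegrable _ _)
      (fun θ _ => hle θ)
    simp only [Pi.add_apply] at this
    rw [intervalIntegral.integral_add ((hci.const_mul (l / 2)).intervalIntegrable _ _)
      intervalIntegrable_const, intervalIntegral.integral_const_mul,
      integral_inv_sq_combination (by positivity) (by linarith),
      intervalIntegral.integral_const] at this
    simpa [period] using this
  have hb' : l / 2 * (2 * Real.pi / (2 * l ^ 2 * b)) ≤ Real.pi / (2 * l) := by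
    rw [show l / 2 * (2 * Real.pi / (2 * l ^ 2 * b)) = Real.pi / (2 * l) / b by field_simp]
    exact div_le_self (by positivity) hb1
  have hfin : period h * l ≤ 3 / 2 * Real.pi := by
    calc period h * l ≤ (Real.pi / (2 * l) + 2 * Real.pi * (1 / (2 * l))) * l := by
          gcongr; linarith
      _ = 3 / 2 * Real.pi := by field_simp; ring
  linarith [Real.pi_lt_d2]

end

theorem integral_abs_sin_of_nonneg {a b : ℝ} (hab : a ≤ b)
    (hs : ∀ x ∈ Set.Icc a b, 0 ≤ Real.sin x) :
    ∫ x in a..b, |Real.sin x| = Real.cos a - Real.cos b := by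
  rw [← integral_sin]
  refine intervalIntegral.integral_congr fun x hx => ?_
  rw [Set.uIcc_of_le hab] at hx
  exact abs_of_nonneg (hs x hx)

theorem integral_abs_sin_of_nonpos {a b : ℝ} (hab : a ≤ b)
    (hs : ∀ x ∈ Set.Icc a b, Real.sin x ≤ 0) :
    ∫ x in a..b, |Real.sin x| = Real.cos b - Real.cos a := by
  rw [← neg_sub, ← integral_sin, ← intervalIntegral.integral_neg]
  refine intervalIntegral.integral_congr fun x hx => ?_
  rw [Set.uIcc_of_le hab] at hx
  exact abs_of_nonpos (hs x hx)

theorem intervalIntegrable_abs_sin (a b : ℝ) :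
    IntervalIntegrable (fun x => |Real.sin x|) MeasureTheory.volume a b :=
  Real.continuous_sin.abs.intervalIntegrable _ _

/-- The total variation of the cosine on an interval symmetric about `π / 2`. -/
theorem integral_abs_sin_symmetric {a : ℝ} (ha : a ∈ Set.Icc (-Real.pi) 0) :
    ∫ x in a..(Real.pi - a), |Real.sin x| = 4 - 2 * Real.cos a := by
  have hpi := Real.pi_pos
  rw [← intervalIntegral.integral_add_adjacent_intervals (b := 0)
    (intervalIntegrable_abs_sin _ _) (intervalIntegrable_abs_sin _ _),
    ← intervalIntegral.integral_add_adjacent_intervals (a := 0) (b := Real.pi)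
    (intervalIntegrable_abs_sin _ _) (intervalIntegrable_abs_sin _ _),
    integral_abs_sin_of_nonpos ha.2 fun x hx =>
      Real.sin_nonpos_of_nonpos_of_neg_pi_le hx.2 (ha.1.trans hx.1),
    integral_abs_sin_of_nonneg hpi.le fun x hx => Real.sin_nonneg_of_mem_Icc hx,
    integral_abs_sin_of_nonpos (by linarith [ha.2]) fun x hx => ?_, Real.cos_pi_sub]
  · simp
    ring
  · rw [← Real.sin_sub_two_pi]
    exact Real.sin_nonpos_of_nonpos_of_neg_pi_le (by linarith [hx.2, ha.1]) (by linarith [hx.1])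

section
variable {h : ℝ}

theorem meanSquare_integrand_le (h0 : 0 < h) (h1 : h < 1 / 2) (θ : ℝ) :
    (2 * h + (1 - 2 * h) * Real.sin θ ^ 2) / (2 * speed h θ) ≤
      h * (speed h θ)⁻¹ + height h / 2 * |Real.sin θ| := by
  have hs := speed_pos h0 h1 θ
  have ha := abs_sin_le_speed h0 h1 θ
  have hp := height_pos h1
  rw [← height_sq h1, ← sq_abs (Real.sin θ)]
  have := mul_le_mul_of_nonneg_left ha (mul_nonneg hp.le (abs_nonneg (Real.sin θ)))
  field_simp
  linarith

theorem le_meanSquare_integrand (h0 : 0 < h) (h1 : h < 1 / 2) (θ : ℝ) :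
    height h / 2 * |Real.sin θ| ≤
      (2 * h + (1 - 2 * h) * Real.sin θ ^ 2) / (2 * speed h θ) := by
  have hs := speed_pos h0 h1 θ
  have hq := speed_sq h0 h1 θ
  rw [← height_sq h1, ← sq_abs (Real.sin θ)]
  rw [← sq_abs (Real.sin θ)] at hq
  -- `2h + p² sin² = (f² + p² sin²) / 2`
  have := sq_nonneg (speed h θ - height h * |Real.sin θ|)
  rw [le_div_iff₀ (by positivity)]
  linarith

theorem integral_abs_sin_two_pi : ∫ x in (0)..(2 * Real.pi), |Real.sin x| = 4 := by
  have hp : Function.Periodic (fun x => |Real.sin x|) (2 * Real.pi) := fun x => by simp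
  have := hp.intervalIntegral_add_eq (-(Real.pi / 2)) 0
  rw [zero_add] at this
  rw [← this, show -(Real.pi / 2) + 2 * Real.pi = Real.pi - -(Real.pi / 2) by ring,
    integral_abs_sin_symmetric ⟨by linarith [Real.pi_pos], by linarith [Real.pi_pos]⟩]
  simp

theorem two_mul_height_le_meanSquare (h0 : 0 < h) (h1 : h < 1 / 2) :
    2 * height h ≤ meanSquare h := by
  have := intervalIntegral.integral_mono_on (μ := MeasureTheory.volume) Real.two_pi_pos.le
    ((intervalIntegrable_abs_sin _ _).const_mul (height h / 2))
    ((continuous_meanSquare_integrand h0 h1).intervalIntegrable _ _)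
    (fun θ _ => le_meanSquare_integrand h0 h1 θ)
  rw [intervalIntegral.integral_const_mul, integral_abs_sin_two_pi] at this
  rw [meanSquare]
  linarith

theorem integral_meanSquare_integrand_le (h0 : 0 < h) (h1 : h < 1 / 2) {a b : ℝ} (hab : a ≤ b) :
    ∫ θ in a..b, (2 * h + (1 - 2 * h) * Real.sin θ ^ 2) / (2 * speed h θ) ≤
      h * (∫ θ in a..b, (speed h θ)⁻¹) + height h / 2 * ∫ θ in a..b, |Real.sin θ| := by
  have hi := ((continuous_inv_speed h0 h1).intervalIntegrable (μ := MeasureTheory.volume)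
    a b).const_mul h
  have hj := (intervalIntegrable_abs_sin a b).const_mul (height h / 2)
  have := intervalIntegral.integral_mono_on (μ := MeasureTheory.volume) hab
    ((continuous_meanSquare_integrand h0 h1).intervalIntegrable _ _) (hi.add hj)
    (fun θ _ => meanSquare_integrand_le h0 h1 θ)
  rwa [intervalIntegral.integral_add hi hj, intervalIntegral.integral_const_mul,
    intervalIntegral.integral_const_mul] at this

theorem height_le_one (h0 : 0 < h) : height h ≤ 1 :=
  Real.sqrt_le_one.2 (by linarith)

theorem meanSquare_le (h0 : 0 < h) (h1 : h < 1 / 2) : meanSquare h ≤ 2 + h * period h := by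
  have := integral_meanSquare_integrand_le h0 h1 Real.two_pi_pos.le
  rw [integral_abs_sin_two_pi] at this
  rw [meanSquare, period]
  linarith [height_le_one h0]

theorem integral_inv_speed_le_period (h0 : 0 < h) (h1 : h < 1 / 2) {a b : ℝ}
    (hab' : b ≤ a + 2 * Real.pi) : ∫ θ in a..b, (speed h θ)⁻¹ ≤ period h := by
  rw [← integral_inv_speed a]
  have hmono : StrictMono fun x => ∫ θ in a..x, (speed h θ)⁻¹ :=
    strictMono_of_hasDerivAt_pos (hasDerivAt_time h0 h1 a)
      fun x => inv_pos.2 (speed_pos h0 h1 x)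
  exact hmono.monotone hab'

theorem integral_orbit_one_sq_pos (h0 : 0 < h) (h1 : h < 1 / 2) {a b : ℝ} (hab : a < b) :
    0 < ∫ θ in a..b, orbit h θ 1 ^ 2 / speed h θ :=
  intervalIntegral.intervalIntegral_pos_of_pos
    ((continuous_orbit_one_sq_div h0 h1).intervalIntegrable _ _)
    (fun θ => div_pos (pow_pos (orbit_pos h0 h1 θ).2 2) (speed_pos h0 h1 θ)) hab

/-! ### Distinguished vectors -/

/-- On the symmetric arc that starts at angle `a`, the displacement in the `y` direction exceeds
`2` by at most `√h` times the period. -/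
theorem integral_orbit_one_sq_symmetric_le (h0 : 0 < h) (h1 : h < 1 / 2) {a : ℝ}
    (ha : a ∈ Set.Ioo (-(Real.pi / 2)) (Real.pi / 2)) :
    (∫ θ in a..(Real.pi - a), orbit h θ 1 ^ 2 / speed h θ) / orbit h a 1 ≤
      2 + √h * period h := by
  have hpi := Real.pi_pos
  have hP : ∫ θ in a..(Real.pi - a), (speed h θ)⁻¹ ≤ period h :=
    integral_inv_speed_le_period h0 h1 (by linarith [ha.1])
  have hab : a ≤ Real.pi - a := by linarith [ha.2]
  have hP0 := period_pos h0 h1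
  obtain ⟨v0, v1⟩ := orbit_pos h0 h1 a
  have hm := orbit_mul h0 h1 a
  have hh := Real.mul_self_sqrt h0.le
  have hh0 := Real.sqrt_nonneg h
  have hp := height_pos h1
  have hsin := (sin_cos_of_orbit (rfl : orbit h a = _)).1
  rcases le_or_gt 0 a with hnn | hneg
  · -- Here `sin θ` stays above its initial value, so `y` is at most its initial value, and `y ≤ √h`.
    have hsa : 0 ≤ Real.sin a := Real.sin_nonneg_of_nonneg_of_le_pi hnn (by linarith [ha.2])
    have hle : ∀ θ ∈ Set.Icc a (Real.pi - a),
        orbit h θ 1 ^ 2 / speed h θ ≤ orbit h a 1 ^ 2 * (speed h θ)⁻¹ := fun θ hθ => by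
      have hs : Real.sin a ≤ Real.sin θ := by
        rcases le_total θ (Real.pi / 2) with hθ' | hθ'
        · exact Real.sin_le_sin_of_le_of_le_pi_div_two (by linarith) hθ' hθ.1
        · rw [← Real.sin_pi_sub θ]
          exact Real.sin_le_sin_of_le_of_le_pi_div_two (by linarith) (by linarith)
            (by linarith [hθ.2])
      obtain ⟨w0, w1⟩ := orbit_pos h0 h1 θ
      have hsθ := (sin_cos_of_orbit (rfl : orbit h θ = _)).1
      have hmθ := orbit_mul h0 h1 θ
      have hdiff := mul_le_mul_of_nonneg_left hs hp.le
      have hle : orbit h θ 1 ≤ orbit h a 1 := by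
        by_contra! hlt
        have := mul_lt_mul'' (show orbit h a 0 < orbit h θ 0 by linarith) hlt v0.le v1.le
        linarith
      rw [div_eq_mul_inv]
      have := (inv_pos.2 (speed_pos h0 h1 θ)).le
      gcongr
    have := intervalIntegral.integral_mono_on (μ := MeasureTheory.volume) hab
      ((continuous_orbit_one_sq_div h0 h1).intervalIntegrable _ _)
      (((continuous_inv_speed h0 h1).intervalIntegrable _ _).const_mul _) hle
    rw [intervalIntegral.integral_const_mul] at this
    have hv : orbit h a 1 ≤ √h := by
      refine Real.le_sqrt_of_sq_le ?_
      have := mul_nonneg hp.le hsa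
      nlinarith
    calc _ ≤ orbit h a 1 ^ 2 * period h / orbit h a 1 := by
          gcongr
          exact this.trans (by gcongr)
      _ = orbit h a 1 * period h := by field_simp
      _ ≤ √h * period h := by gcongr
      _ ≤ 2 + √h * period h := by linarith
  · have hint := integral_meanSquare_integrand_le h0 h1 hab
    rw [integral_abs_sin_symmetric ⟨by linarith [ha.1], hneg.le⟩] at hint
    have heq : ∫ θ in a..(Real.pi - a), orbit h θ 1 ^ 2 / speed h θ =
        (∫ θ in a..(Real.pi - a), (2 * h + (1 - 2 * h) * Real.sin θ ^ 2) / (2 * speed h θ)) -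
          height h * Real.cos a := by
      simp only [orbit_one_sq_div h0 h1]
      rw [intervalIntegral.integral_sub
        ((continuous_meanSquare_integrand h0 h1).intervalIntegrable _ _)
        (Continuous.intervalIntegrable (by fun_prop) _ _), intervalIntegral.integral_const_mul,
        integral_sin, Real.cos_pi_sub]
      ring
    have hc0 : 0 ≤ Real.cos a := Real.cos_nonneg_of_mem_Icc ⟨ha.1.le, ha.2.le⟩
    have hs0 : Real.sin a ≤ 0 := Real.sin_nonpos_of_nonpos_of_neg_pi_le hneg.le (by linarith [ha.1])
    have hc : 1 - Real.cos a ≤ -Real.sin a := by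
      nlinarith [Real.sin_sq_add_cos_sq a, Real.neg_one_le_sin a, Real.cos_le_one a]
    have hpc : height h * (1 - Real.cos a) ≤ orbit h a 1 := by
      have := mul_le_mul_of_nonneg_left hc hp.le
      linarith
    have hv : √h ≤ orbit h a 1 := by
      refine Real.sqrt_le_iff.2 ⟨v1.le, ?_⟩
      have := mul_nonneg hp.le (neg_nonneg.2 hs0)
      nlinarith
    have hhP : h * (∫ θ in a..(Real.pi - a), (speed h θ)⁻¹) ≤ √h * period h * orbit h a 1 := by
      calc _ ≤ h * period h := by gcongr
        _ = √h * period h * √h := by linear_combination -period h * hh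
        _ ≤ _ := by gcongr
    rw [div_le_iff₀ v1, heq]
    linarith

end

/-- The flowline, its period and the exponential map, all read off from one angle function. -/
theorem exists_flow_angle {h : ℝ} (h0 : 0 < h) (h1 : h < 1 / 2) (θ₀ : ℝ) :
    ∃ θ : ℝ → ℝ, θ 0 = θ₀ ∧ StrictMono θ ∧ θ (period h) = θ₀ + 2 * Real.pi ∧
      IsFlowFrom (fun t => orbit h (θ t)) (orbit h θ₀) ∧
      ∀ T, solExp (T • orbit h θ₀) =
      !₂[(∫ x in θ₀..θ T, orbit h x 0 ^ 2 / speed h x) / orbit h θ₀ 0,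
        (∫ x in θ₀..θ T, orbit h x 1 ^ 2 / speed h x) / orbit h θ₀ 1,
        Real.log (orbit h (θ T) 0 / orbit h θ₀ 0)] := by
  obtain ⟨θ, hθ0, hθ, hmono, hinv⟩ := exists_angle h0 h1 θ₀
  refine ⟨θ, hθ0, hmono, ?_, ?_, fun T => ?_⟩
  · rw [← integral_inv_speed θ₀, hinv]
  · rw [← hθ0]
    exact isFlowFrom_orbit h0 h1 hθ
  · rw [← hθ0]
    exact solExp_smul_orbit h0 h1 hθ T

theorem sqrt_mul_period_le {h : ℝ} (h0 : 0 < h) (h1 : h < 1 / 2) :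
    √h * period h ≤ 25 / period h := by
  have hP := period_pos h0 h1
  have hl := period_mul_le h0 h1
  have hl0 : 0 ≤ √√h := Real.sqrt_nonneg _
  have hl2 : √√h ^ 2 = √h := Real.sq_sqrt (Real.sqrt_nonneg h)
  rw [le_div_iff₀ hP, ← hl2]
  nlinarith [mul_nonneg hP.le hl0]

theorem norm_smul_direction (V : E3) : ‖V‖ • direction V = V := by
  by_cases hV : V = 0
  · simp [hV, direction]
  · rw [direction, smul_smul, mul_inv_cancel₀ (norm_ne_zero_iff.2 hV), one_smul]

/-- A small symmetric flowline in the positive sector runs from an angle `a` to `π - a`, and the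
flowline of a distinguished vector is an initial part of it. -/
theorem solExp_one_le_of_isDistinguished {V : E3} (hV : IsPositive V) (hd : IsDistinguished V)
    {L : ℝ} (hL : InLoopLevelSet (direction V) L) :
    0 < L ∧ 0 < solExp V 1 ∧ solExp V 1 ≤ 2 + 25 / L := by
  have hVn : 0 < ‖V‖ := norm_pos_iff.2 fun h => by simpa [h] using hV 0
  have hpi := Real.pi_pos
  have hdir : ∀ i, 0 < direction V i := fun i => mul_pos (inv_pos.2 hVn) (hV i)
  obtain ⟨T, hT, hT0, ⟨L', hL', hTL'⟩, φ, hφ, hφT⟩ := hd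
  have hE : solExp V = solExp (‖V‖ • direction V) := by rw [norm_smul_direction]
  set u := direction V
  have h0 : 0 < u 0 * u 1 := mul_pos (hdir 0) (hdir 1)
  have h1 : u 0 * u 1 < 1 / 2 := by
    have := norm_sq_eq u
    rw [hL.1] at this
    nlinarith [sq_nonneg (u 0 - u 1), pow_pos (hdir 2) 2]
  obtain ⟨a, ha, hau⟩ := exists_orbit_eq hL.1 (hdir 0) (hdir 1) h1
  generalize hh : u 0 * u 1 = h at h0 h1 hau
  obtain ⟨θ, hθ0, hmono, hper, hflow, hexp⟩ := exists_flow_angle h0 h1 a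
  rw [← hau] at hL hL' hφ hE
  rw [inLoopLevelSet_orbit h0 h1] at hL hL'
  subst hL hL'
  rw [hφ.unique hflow] at hφT
  have hp := height_pos h1
  obtain ⟨s1, c1⟩ := sin_cos_of_orbit hau
  obtain ⟨s2, c2⟩ := sin_cos_of_orbit hφT
  simp only [Matrix.cons_val] at s2 c2
  have hs : Real.sin (θ T) = Real.sin a := mul_left_cancel₀ hp.ne' (by linarith)
  have hc : Real.cos (θ T) = -Real.cos a := mul_left_cancel₀ hp.ne' (by linarith)
  have hca : 0 < Real.cos a := by
    by_contra! hn
    nlinarith [hdir 2]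
  have haI : a ∈ Set.Ioo (-(Real.pi / 2)) (Real.pi / 2) := by
    constructor
    · by_contra! hn
      have := Real.cos_nonpos_of_pi_div_two_le_of_le (x := -a) (by linarith) (by linarith [ha.1])
      rw [Real.cos_neg] at this
      linarith
    · by_contra! hn
      have := Real.cos_nonpos_of_pi_div_two_le_of_le hn (by linarith [ha.2])
      linarith
  have hTlo := hmono hT0
  have hThi := hmono hTL'
  rw [hθ0] at hTlo
  rw [hper] at hThi
  have hθT : θ T = Real.pi - a := by
    have hone : Real.cos (θ T + a - Real.pi) = 1 := by
      rw [Real.cos_sub_pi, Real.cos_add, hs, hc]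
      linarith [Real.sin_sq_add_cos_sq a]
    rw [Real.cos_eq_one_iff_of_lt_of_lt (by linarith [haI.1]) (by linarith [haI.2])] at hone
    linarith
  have hVlo := hmono hVn
  have hVhi := hmono.monotone hT
  rw [hθ0] at hVlo
  rw [hθT] at hVhi
  rw [hE, hexp]
  simp only [Matrix.cons_val]
  have hv1 := (orbit_pos h0 h1 a).2
  refine ⟨period_pos h0 h1, div_pos (integral_orbit_one_sq_pos h0 h1 hVlo) hv1, ?_⟩
  have hmonoI : ∫ x in a..θ ‖V‖, orbit h x 1 ^ 2 / speed h x ≤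
      ∫ x in a..(Real.pi - a), orbit h x 1 ^ 2 / speed h x := by
    have hi := fun x y => (continuous_orbit_one_sq_div h0 h1).intervalIntegrable
      (μ := MeasureTheory.volume) x y
    rw [← intervalIntegral.integral_add_adjacent_intervals (hi a (θ ‖V‖))
      (hi (θ ‖V‖) (Real.pi - a))]
    have := intervalIntegral.integral_nonneg (μ := MeasureTheory.volume) hVhi fun x _ =>
      div_nonneg (sq_nonneg (orbit h x 1)) (speed_pos h0 h1 x).le
    linarith
  calc _ ≤ (∫ x in a..(Real.pi - a), orbit h x 1 ^ 2 / speed h x) / orbit h a 1 := by gcongr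
    _ ≤ 2 + √h * period h := integral_orbit_one_sq_symmetric_le h0 h1 haI
    _ ≤ _ := by linarith [sqrt_mul_period_le h0 h1]

/-! ### The cut-locus image in the positive quadrant of the plane `z = 0` -/

theorem isFlowFrom_const {u : E3} (hu : structureField u = 0) : IsFlowFrom (fun _ => u) u :=
  ⟨rfl, fun t => by rw [hu]; exact hasDerivAt_const t u⟩

theorem structureField_eq_zero {u : E3} (h01 : u 0 = u 1) (h2 : u 2 = 0) :
    structureField u = 0 := by
  ext i
  fin_cases i <;> simp [structureField, h01, h2]

theorem not_inLoopLevelSet_of_structureField_eq_zero {u : E3} (hu : structureField u = 0) (L : ℝ) :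
    ¬ InLoopLevelSet u L := by
  rintro ⟨-, φ, hφ, hL⟩
  rw [hφ.unique (isFlowFrom_const hu)] at hL
  have hL0 : 0 < L := hL.1.1
  have : L ≤ L / 2 := hL.2 ⟨by linarith, rfl⟩
  linarith

theorem solExp_of_structureField_eq_zero {u : E3} (hu : structureField u = 0) (h2 : u 2 = 0) :
    solExp u = u := by
  have := solExp_smul (isFlowFrom_const hu) (X := fun t => u 0 * t) (Y := fun t => u 1 * t)
    (Z := fun _ => 0) (fun t => by simpa using (hasDerivAt_id t).const_mul (u 0))
    (fun t => by simpa using (hasDerivAt_id t).const_mul (u 1))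
    (fun t => by simpa [h2] using hasDerivAt_const t (0 : ℝ)) (by simp) (by simp) rfl 1
  rw [one_smul] at this
  rw [this]
  ext i
  fin_cases i <;> simp [h2]

/-- A full turn around a level set returns to the plane `z = 0`. -/
theorem solExp_period_smul {h : ℝ} (h0 : 0 < h) (h1 : h < 1 / 2) (θ₀ : ℝ) :
    solExp (period h • orbit h θ₀) =
      !₂[meanSquare h / orbit h θ₀ 0, meanSquare h / orbit h θ₀ 1, 0] := by
  obtain ⟨θ, -, -, hper, -, hexp⟩ := exists_flow_angle h0 h1 θ₀
  rw [hexp, hper, integral_orbit_zero_sq h0 h1, integral_orbit_one_sq h0 h1, orbit_periodic,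
    div_self (orbit_pos h0 h1 θ₀).1.ne', Real.log_one]

theorem meanSquare_pos {h : ℝ} (h0 : 0 < h) (h1 : h < 1 / 2) : 0 < meanSquare h := by
  linarith [two_mul_height_le_meanSquare h0 h1, height_pos h1]

/-- The point `(a, b)` lies on the arc of the hyperbola `a b = meanSquare h ^ 2 / h` that the
vectors making one full turn around some level `h` trace out. The inequality says that the unit
vector proportional to `(meanSquare h / a, meanSquare h / b, _)` exists. -/
def OnHyperbolicArc (a b : ℝ) : Prop :=
  ∃ h, 0 < h ∧ h < 1 / 2 ∧ h * (a ^ 2 + b ^ 2) ≤ a * b ∧ a * b * h = meanSquare h ^ 2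

theorem onHyperbolicArc_comm {a b : ℝ} : OnHyperbolicArc a b ↔ OnHyperbolicArc b a := by
  simp only [OnHyperbolicArc, add_comm (a ^ 2), mul_comm a]

theorem mem_cutLocusImage_iff {a b : ℝ} (ha : 0 < a) (hb : 0 < b)
    (hne : ¬ (a = Real.pi ∧ b = Real.pi)) :
    !₂[a, b, 0] ∈ cutLocusImage ↔ OnHyperbolicArc a b := by
  constructor
  · rintro ⟨V, hV, hE⟩
    have hV0 : 0 < V 0 := pos_of_solExp_pos.1 (by simpa [hE] using ha)
    have hV1 : 0 < V 1 := pos_of_solExp_pos.2 (by simpa [hE] using hb)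
    rcases hV with hL | ⟨e0, e1, e2⟩
    · have hVn : 0 < ‖V‖ := norm_pos_iff.2 fun h => by simp [h] at hV0
      have hu0 : 0 < direction V 0 := mul_pos (inv_pos.2 hVn) hV0
      have hu1 : 0 < direction V 1 := mul_pos (inv_pos.2 hVn) hV1
      rw [← norm_smul_direction V] at hE
      set u := direction V
      have hn := norm_sq_eq u
      rw [hL.1] at hn
      have h0 : 0 < u 0 * u 1 := mul_pos hu0 hu1
      have h1 : u 0 * u 1 < 1 / 2 := by
        by_contra! hge
        refine not_inLoopLevelSet_of_structureField_eq_zero (structureField_eq_zero ?_ ?_) _ hL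
        · nlinarith [sq_nonneg (u 0 - u 1), sq_nonneg (u 2)]
        · nlinarith [sq_nonneg (u 0 - u 1), sq_nonneg (u 2)]
      obtain ⟨θ, -, hθ⟩ := exists_orbit_eq hL.1 hu0 hu1 h1
      generalize hh : u 0 * u 1 = h at h0 h1 hθ
      rw [← hθ, inLoopLevelSet_orbit h0 h1] at hL
      rw [hL, ← hθ, solExp_period_smul h0 h1, hθ] at hE
      have ea : meanSquare h / u 0 = a := by simpa using congrArg (fun w : E3 => w 0) hE
      have eb : meanSquare h / u 1 = b := by simpa using congrArg (fun w : E3 => w 1) hE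
      refine ⟨h, h0, h1, ?_, ?_⟩
      · rw [← ea, ← eb, ← hh]
        field_simp
        nlinarith [sq_nonneg (u 2)]
      · rw [← ea, ← eb, ← hh]
        field_simp
    · rw [abs_of_pos hV0] at e0
      rw [abs_of_pos hV1] at e1
      rw [solExp_of_structureField_eq_zero (structureField_eq_zero (e0.trans e1.symm) e2) e2] at hE
      subst hE
      exact absurd ⟨e0, e1⟩ hne
  · rintro ⟨h, h0, h1, hle, heq⟩
    have hI := meanSquare_pos h0 h1
    have hm : meanSquare h / a * (meanSquare h / b) = h := by
      field_simp
      linarith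
    have hsum : (meanSquare h / a) ^ 2 + (meanSquare h / b) ^ 2 ≤ 1 := by
      rw [div_pow, div_pow, ← heq]
      field_simp
      linarith
    set u : E3 := !₂[meanSquare h / a, meanSquare h / b,
      √(1 - ((meanSquare h / a) ^ 2 + (meanSquare h / b) ^ 2))] with hu
    have hn : ‖u‖ = 1 := by
      rw [← sq_eq_sq₀ (norm_nonneg _) zero_le_one, norm_sq_eq]
      simp only [hu, Matrix.cons_val]
      rw [Real.sq_sqrt (by linarith)]
      ring
    have hm' : u 0 * u 1 = h := hm
    obtain ⟨θ, -, hθ⟩ := exists_orbit_eq hn (div_pos hI ha) (div_pos hI hb) (by rw [hm']; exact h1)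
    rw [hm'] at hθ
    have hP := period_pos h0 h1
    have hnorm : ‖period h • u‖ = period h := by
      rw [norm_smul, hn, mul_one, Real.norm_of_nonneg hP.le]
    have hdir : direction (period h • u) = u := by
      rw [direction, hnorm, smul_smul, inv_mul_cancel₀ hP.ne', one_smul]
    refine ⟨period h • u, Or.inl ?_, ?_⟩
    · rw [hdir, hnorm, ← hθ, inLoopLevelSet_orbit h0 h1]
    · rw [← hθ, solExp_period_smul h0 h1, hθ]
      simp only [hu, Matrix.cons_val]
      rw [div_div_cancel₀ hI.ne', div_div_cancel₀ hI.ne']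

/-- The lower bound of the boundary curve: for bounded `b` the level is at most `b / a`, and
`meanSquare h ≤ b`. -/
theorem OnHyperbolicArc.le {a b : ℝ} (ha : 4 ≤ a) (hb : 0 < b) (hab : OnHyperbolicArc a b) :
    2 - 8 / a ≤ b := by
  obtain ⟨h, h0, h1, hle, heq⟩ := hab
  by_contra! hlt
  have ha0 : 0 < a := by linarith
  have hb2 : b < 2 := by linarith [div_pos (show (0 : ℝ) < 8 by norm_num) ha0]
  have hba : h * a ≤ b := by nlinarith [mul_nonneg h0.le (sq_nonneg b)]
  have hI := two_mul_height_le_meanSquare h0 h1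
  have hIpos := meanSquare_pos h0 h1
  have hIb : meanSquare h ≤ b := by
    refine (sq_le_sq₀ hIpos.le hb.le).1 ?_
    nlinarith
  have hp : 1 - 2 * h ≤ height h :=
    Real.le_sqrt_of_sq_le (by nlinarith)
  have hha : h ≤ 2 / a := by
    rw [le_div_iff₀ ha0]
    linarith
  have : 8 / a = 4 * (2 / a) := by ring
  linarith

theorem exists_forall_mul_period_le {ε : ℝ} (hε : 0 < ε) :
    ∃ δ > 0, ∀ h, 0 < h → h < 1 / 2 → h < δ → h * period h ≤ ε := by
  refine ⟨(ε / 5) ^ 2, by positivity, fun h h0 h1 hδ => ?_⟩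
  have hl := period_mul_le h0 h1
  have hs0 := Real.sqrt_nonneg h
  have hl1 : √√h ≤ 1 := Real.sqrt_le_one.2 (Real.sqrt_le_one.2 (by linarith))
  have hl2 : √√h ^ 2 = √h := Real.sq_sqrt (Real.sqrt_nonneg h)
  have hh := Real.mul_self_sqrt h0.le
  have hsε : √h ≤ ε / 5 := Real.sqrt_le_iff.2 ⟨by positivity, hδ.le⟩
  have hP := (period_pos h0 h1).le
  calc h * period h = √h * √√h * (period h * √√h) := by
        linear_combination (-period h) * hh - √h * period h * hl2
    _ ≤ (ε / 5) * 1 * 5 := by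
        gcongr
    _ = ε := by ring

theorem exists_onHyperbolicArc {ε : ℝ} (hε : 0 < ε) (hε1 : ε ≤ 1) :
    ∃ R, ∀ a, R < a → ∃ b, 0 < b ∧ b < 2 + ε ∧ OnHyperbolicArc a b := by
  obtain ⟨δ, hδ, hper⟩ := exists_forall_mul_period_le (show 0 < ε / 5 by positivity)
  refine ⟨4 + 2 / δ + 100 / ε, fun a ha => ?_⟩
  have hd0 : 0 < 2 / δ := by positivity
  have he0 : 0 < 100 / ε := by positivity
  have ha4 : 4 < a := by linarith
  have ha0 : 0 < a := by linarith
  -- On this level the equation `ab h = meanSquare h ^ 2` gives `b` slightly above `2`.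
  set h := (2 - ε / 4) / a with hh
  have hha : h * a = 2 - ε / 4 := div_mul_cancel₀ _ ha0.ne'
  have h0 : 0 < h := div_pos (by linarith) ha0
  have h1 : h < 1 / 2 := by
    rw [hh, div_lt_iff₀ ha0]
    linarith
  have hhδ : h < δ := by
    rw [hh, div_lt_iff₀ ha0]
    have : 2 / δ < a := by linarith
    rw [div_lt_iff₀ hδ] at this
    linarith
  have hhε : h * 50 ≤ ε := by
    have : 100 / ε < a := by linarith
    rw [div_lt_iff₀ hε] at this
    nlinarith
  have hP := hper h h0 h1 hhδ
  have hP0 := mul_pos h0 (period_pos h0 h1)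
  have hI1 := two_mul_height_le_meanSquare h0 h1
  have hI2 := meanSquare_le h0 h1
  have hI := meanSquare_pos h0 h1
  have hp2 := height_sq h1
  have hp := height_pos h1
  have hIsq : 4 - 8 * h ≤ meanSquare h ^ 2 := by nlinarith
  have hIup : meanSquare h ^ 2 ≤ 4 + ε := by nlinarith
  have hbdef : meanSquare h ^ 2 / (h * a) * (h * a) = meanSquare h ^ 2 :=
    div_mul_cancel₀ _ (mul_pos h0 ha0).ne'
  set b := meanSquare h ^ 2 / (h * a)
  have hb0 : 0 < b := div_pos (pow_pos hI 2) (mul_pos h0 ha0)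
  rw [hha] at hbdef
  have hbup : b < 2 + ε := by
    by_contra! hge
    nlinarith
  refine ⟨b, hb0, hbup, h, h0, h1, ?_, ?_⟩
  · have hab : a * b * h = meanSquare h ^ 2 := by
      rw [← hbdef, ← hha]
      ring
    have hb2 : h ^ 2 * b ^ 2 ≤ h := by
      have hb3 : b ^ 2 ≤ 9 := by nlinarith
      have : h * b ^ 2 ≤ 1 := by nlinarith
      nlinarith
    have key : h * (h * (a ^ 2 + b ^ 2)) ≤ h * (a * b) := by
      have e1 : h * (h * (a ^ 2 + b ^ 2)) = (h * a) ^ 2 + h ^ 2 * b ^ 2 := by ring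
      rw [e1, hha]
      nlinarith
    exact le_of_mul_le_mul_left key h0
  · rw [← hbdef, ← hha]
    ring

theorem exists_isGLB_onHyperbolicArc {ε : ℝ} (hε : 0 < ε) :
    ∃ R : ℝ, Real.pi < R ∧ ∀ a : ℝ, R < a →
      ∃ β : ℝ, IsGLB {b : ℝ | 0 < b ∧ OnHyperbolicArc a b} β ∧ |β - 2| < ε := by
  obtain ⟨R, hR⟩ := exists_onHyperbolicArc (ε := min (ε / 2) 1) (by positivity) (min_le_right _ _)
  refine ⟨max (max R 4) (8 / (ε / 2)), ?_, fun a ha => ?_⟩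
  · exact Real.pi_lt_four.trans_le ((le_max_right _ _).trans (le_max_left _ _))
  have ha4 : 4 < a := ((le_max_right _ _).trans (le_max_left _ _)).trans_lt ha
  have haε : 8 / (ε / 2) < a := (le_max_right _ _).trans_lt ha
  obtain ⟨b, hb0, hb, hab⟩ := hR a (((le_max_left _ _).trans (le_max_left _ _)).trans_lt ha)
  have hlow : ∀ c ∈ {b : ℝ | 0 < b ∧ OnHyperbolicArc a b}, 2 - 8 / a ≤ c :=
    fun c hc => hc.2.le ha4.le hc.1
  have hne : {b : ℝ | 0 < b ∧ OnHyperbolicArc a b}.Nonempty := ⟨b, hb0, hab⟩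
  refine ⟨_, isGLB_csInf hne ⟨_, hlow⟩, ?_⟩
  have h1 := le_csInf hne hlow
  have h2 := csInf_le ⟨_, hlow⟩ (show b ∈ {b : ℝ | 0 < b ∧ OnHyperbolicArc a b} from ⟨hb0, hab⟩)
  have h3 := min_le_left (ε / 2) 1
  have h4 : 8 / a < ε / 2 := by
    rw [div_lt_iff₀ (by positivity)] at haε
    rw [div_lt_iff₀ (by linarith)]
    linarith
  rw [abs_lt]
  constructor <;> linarith

end SolGeom

theorem theorem6p1 :
    (∀ ε : ℝ, 0 < ε → ∃ L₀ : ℝ, ∀ L : ℝ, L₀ < L → ∀ V : SolGeom.E3,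
      SolGeom.IsPositive V → SolGeom.IsDistinguished V →
      SolGeom.InLoopLevelSet (SolGeom.direction V) L →
        SolGeom.solExp V 1 ∈ Set.Ioo 0 (2 + ε)) ∧
    (∀ ε : ℝ, 0 < ε → ∃ R : ℝ, ∀ a : ℝ, R < a →
      ∃ β : ℝ, IsGLB {b : ℝ | 0 < b ∧ !₂[a, b, 0] ∈ SolGeom.cutLocusImage} β ∧ |β - 2| < ε) ∧
    (∀ ε : ℝ, 0 < ε → ∃ R : ℝ, ∀ b : ℝ, R < b →
      ∃ α : ℝ, IsGLB {a : ℝ | 0 < a ∧ !₂[a, b, 0] ∈ SolGeom.cutLocusImage} α ∧ |α - 2| < ε) := by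
  refine ⟨fun ε hε => ⟨25 / ε, fun L hL V hV hd hloop => ?_⟩, fun ε hε => ?_, fun ε hε => ?_⟩
  · obtain ⟨hL0, hpos, hle⟩ := SolGeom.solExp_one_le_of_isDistinguished hV hd hloop
    refine ⟨hpos, hle.trans_lt ?_⟩
    rw [div_lt_iff₀ hε] at hL
    have : 25 / L < ε := by
      rw [div_lt_iff₀ hL0]
      linarith
    linarith
  · obtain ⟨R, hRpi, hR⟩ := SolGeom.exists_isGLB_onHyperbolicArc hε
    refine ⟨R, fun a ha => ?_⟩
    have hset : {b : ℝ | 0 < b ∧ !₂[a, b, 0] ∈ SolGeom.cutLocusImage} =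
        {b : ℝ | 0 < b ∧ SolGeom.OnHyperbolicArc a b} :=
      Set.ext fun b => and_congr_right fun hb =>
        SolGeom.mem_cutLocusImage_iff (by linarith [Real.pi_pos]) hb (by rintro ⟨rfl, -⟩; linarith)
    rw [hset]
    exact hR a ha
  · obtain ⟨R, hRpi, hR⟩ := SolGeom.exists_isGLB_onHyperbolicArc hε
    refine ⟨R, fun b hb => ?_⟩
    have hset : {a : ℝ | 0 < a ∧ !₂[a, b, 0] ∈ SolGeom.cutLocusImage} =
        {a : ℝ | 0 < a ∧ SolGeom.OnHyperbolicArc b a} :=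
      Set.ext fun a => and_congr_right fun ha =>
        (SolGeom.mem_cutLocusImage_iff ha (by linarith [Real.pi_pos])
          (by rintro ⟨-, rfl⟩; linarith)).trans SolGeom.onHyperbolicArc_comm
    rw [hset]
    exact hR b hb
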